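/- Let $\alpha\in(0,1)\cup(1,2)$. For $m\ge 1$, an $m$-point Gauss–Radau–Jacobi quadrature with endpoint $t_m=1$ consists of real nodes $t_1<\dots<t_m=1$ and real weights $w_1,\dots,w_m$ such that $$\int_0^1 p(t)\,t^{\alpha-1}(1-t)^{1-\alpha}\,dt=\sum_{i=1}^m w_i\,p(t_i)$$ for every real polynomial $p$ of degree at most $2m-2$. For every $m\ge1$ such a quadrature exists, and for each one $t_i\in(0,1]$ and $w_i>0$ for all $i$. Let moreover $H$ be a finite-dimensional complex Hilbert space and let $\rho,\sigma$ be positive semidefinite operators on $H$ with $\rho\ll\sigma$, i.e. $\ker\sigma\subseteq\ker\rho$ (negative powers of $\sigma$ are taken on its support). For $m\geq 1$ and an $m$-point quadrature as above put $$B_m:=C_m+\frac{\sin(\alpha\pi)}{\pi}\sum_{i=1}^m\frac{w_i}{t_i}\,\inf_Z\Big(\operatorname{Tr}\big[\rho\,(Z+Z^\dagger+(1-t_i)Z^\dagger Z)\big]+t_i\operatorname{Tr}\big[\sigma ZZ^\dagger\big]\Big),$$ $$C_m:=\operatorname{Tr}[\rho]\Big(1+\frac{\sin(\alpha\pi)}{\pi}\sum_{i=1}^m\frac{w_i}{t_i}\Big),$$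 where each infimum is over all linear operators $Z$ on $H$. All these infima are finite. If $\alpha\in(0,1)$, then $\operatorname{Tr}[\rho^\alpha\sigma^{1-\alpha}]\ge B_m$ for every $m\ge1$; if $\alpha\in(1,2)$, then $\operatorname{Tr}[\rho^\alpha\sigma^{1-\alpha}]\le B_m$ for every $m\ge1$. In both cases $B_m\to\operatorname{Tr}[\rho^\alpha\sigma^{1-\alpha}]$ as $m\to\infty$. -/

import Mathlib

open MeasureTheory Filter Topology

noncomputable section

namespace PetzRenyi

/-- The Jacobi-type weight `t ^ (α - 1) * (1 - t) ^ (1 - α)` on `[0, 1]`. -/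
def jacobiWeight (α t : ℝ) : ℝ :=
  t ^ (α - 1) * (1 - t) ^ (1 - α)

/-- The nodes `t` (listed in increasing order) and the weights `w` form an `m`-point
Gauss-Radau-Jacobi quadrature rule with prescribed node `1` for the weight function
`t ^ (α - 1) * (1 - t) ^ (1 - α)` on `[0, 1]`: the last node is `1`, and the rule integrates every
real polynomial of degree at most `2 * m - 2` exactly. -/
structure IsGaussRadauJacobi (α : ℝ) (m : ℕ) (t w : Fin m → ℝ) : Prop where
  strictMono : StrictMono t
  last_node : ∀ i : Fin m, (i : ℕ) + 1 = m → t i = 1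
  exact : ∀ p : Polynomial ℝ, p.natDegree + 2 ≤ 2 * m →
    ∫ s in (0 : ℝ)..1, p.eval s * jacobiWeight α s = ∑ i, w i * p.eval (t i)

section Operators

variable {H : Type*} [NormedAddCommGroup H] [InnerProductSpace ℂ H] [CompleteSpace H]

/-- The (real part of the) trace of an operator. It is used only for operators whose trace is
real. -/
def tr (A : H →L[ℂ] H) : ℝ :=
  (LinearMap.trace ℂ H (A : H →ₗ[ℂ] H)).re

/-- `ρ ≪ σ`, that is, `ker σ ⊆ ker ρ`. -/
def Dominated (ρ σ : H →L[ℂ] H) : Prop :=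
  ∀ v : H, σ v = 0 → ρ v = 0

/-- `Tr[ρ ^ α * σ ^ (1 - α)]`. Powers of positive semidefinite operators are taken by the functional
calculus, with `0 ^ s = 0` for every real `s ≠ 0`; so negative powers are those of the
pseudo-inverse, that is, they are taken on the support. -/
def petzTrace (α : ℝ) (ρ σ : H →L[ℂ] H) : ℝ :=
  tr (ρ ^ α * σ ^ (1 - α))

/-- The objective function `Tr[ρ (Z + Z† + (1 - t) Z† Z)] + t Tr[σ Z Z†]`. -/
def objective (ρ σ : H →L[ℂ] H) (t : ℝ) (Z : H →L[ℂ] H) : ℝ :=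
  tr (ρ * (Z + star Z + ((1 - t : ℝ) : ℂ) • (star Z * Z))) + t * tr (σ * (Z * star Z))

/-- The variational bound generated by the nodes `t` and the weights `w`, including the constant
`C = Tr[ρ] (1 + (sin (α π) / π) ∑ i, w i / t i)`. -/
def quadratureBound (α : ℝ) {m : ℕ} (t w : Fin m → ℝ) (ρ σ : H →L[ℂ] H) : ℝ :=
  tr ρ * (1 + Real.sin (α * Real.pi) / Real.pi * ∑ i, w i / t i)
    + Real.sin (α * Real.pi) / Real.pi *
        ∑ i, w i / t i * ⨅ Z : H →L[ℂ] H, objective ρ σ (t i) Z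

end Operators

end PetzRenyi

end

namespace PetzRenyi

/-! The operator statement reduces to one about pairs of numbers. Take eigenbases `e` of ρ and `f`
of σ, with eigenvalues r_j and s_k. In the matrix entries ⟨f_k, Z e_j⟩ the objective is a sum of
independent quadratics, and completing squares gives the minimum (`isLeast_range_objective`). Both
the bound and the trace then become sums of functions of (r_j, s_k) with the same nonnegative
coefficients |⟨e_j, f_k⟩|² (`quadratureBound_eq_sum`, `petzTrace_eq_sum`). Domination makes r_j⟨e_j,
f_k⟩ vanish when s_k = 0, so only positive pairs matter.

For r, s > 0, r^α s^(1-α) equals r plus sin(απ)/π times the integral of r(s-r)/(r+t(s-r)) against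
the Jacobi weight (`integral_rational_mul_jacobiWeight`); the scalar bound replaces this integral by
the quadrature. As a function of t the integrand has at most one, simple, pole, outside [0,1]. Its
interpolant at the nodes, double except at t = 1, has an explicit nonnegative error, so every rule
underestimates the integral (`IsGaussRadauJacobi.sum_rational_le_integral`). The sign of sin(απ)
turns this into a lower bound for α < 1 and an upper bound for α > 1.

Convergence follows from polynomial approximation, exactness and positive weights
(`tendsto_quadrature`). The nodes of a rule are 1 and the roots of the degree m-1 orthogonal
polynomial for (1-t) times the weight. -/

/-! ### Beta integrals and the Jacobi weight. -/

theorem ofReal_betaIntegrand (a b : ℝ) {t : ℝ} (ht : t ∈ Set.Icc (0 : ℝ) 1) :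
    (t : ℂ) ^ ((a : ℂ) - 1) * (1 - (t : ℂ)) ^ ((b : ℂ) - 1) =
      ((t ^ (a - 1) * (1 - t) ^ (b - 1) : ℝ) : ℂ) := by
  rw [Complex.ofReal_mul, Complex.ofReal_cpow ht.1, Complex.ofReal_cpow (sub_nonneg.2 ht.2)]
  push_cast
  rfl

theorem intervalIntegrable_betaIntegrand {a b : ℝ} (ha : 0 < a) (hb : 0 < b) :
    IntervalIntegrable (fun t : ℝ => t ^ (a - 1) * (1 - t) ^ (b - 1)) volume 0 1 := by
  have h := Complex.betaIntegral_convergent (u := (a : ℂ)) (v := (b : ℂ)) (by simpa) (by simpa)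
  rw [intervalIntegrable_iff_integrableOn_Ioc_of_le zero_le_one] at h ⊢
  have h' : IntegrableOn (fun t : ℝ => ((t ^ (a - 1) * (1 - t) ^ (b - 1) : ℝ) : ℂ))
      (Set.Ioc 0 1) := by
    refine h.congr_fun (fun t ht => ?_) measurableSet_Ioc
    exact ofReal_betaIntegrand a b ⟨ht.1.le, ht.2⟩
  exact h'.re

theorem integral_betaIntegrand {a b : ℝ} (ha : 0 < a) (hb : 0 < b) :
    ∫ t in (0 : ℝ)..1, t ^ (a - 1) * (1 - t) ^ (b - 1) =
      Real.Gamma a * Real.Gamma b / Real.Gamma (a + b) := by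
  rw [← Complex.ofReal_inj, ← intervalIntegral.integral_ofReal]
  have h := Complex.betaIntegral_eq_Gamma_mul_div (a : ℂ) (b : ℂ) (by simpa) (by simpa)
  push_cast
  rw [← Complex.Gamma_ofReal, ← Complex.Gamma_ofReal, ← Complex.Gamma_ofReal, Complex.ofReal_add,
    ← h, Complex.betaIntegral]
  refine intervalIntegral.integral_congr fun t ht => ?_
  rw [Set.uIcc_of_le zero_le_one] at ht
  have := ofReal_betaIntegrand a b ht
  push_cast at this
  exact this.symm

theorem integral_betaIntegrand_one_sub {a : ℝ} (h0 : 0 < a) (h1 : a < 1) :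
    ∫ t in (0 : ℝ)..1, t ^ (a - 1) * (1 - t) ^ (-a) = Real.pi / Real.sin (a * Real.pi) := by
  have h := integral_betaIntegrand h0 (sub_pos.2 h1)
  rw [show 1 - a - 1 = -a by ring, show a + (1 - a) = 1 by ring, Real.Gamma_one, div_one,
    Real.Gamma_mul_Gamma_one_sub, mul_comm Real.pi a] at h
  exact h

theorem intervalIntegrable_jacobiWeight {α : ℝ} (h0 : 0 < α) (h2 : α < 2) :
    IntervalIntegrable (jacobiWeight α) volume 0 1 := by
  have h := intervalIntegrable_betaIntegrand h0 (sub_pos.2 h2)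
  rw [show 2 - α - 1 = 1 - α by ring] at h
  exact h

theorem intervalIntegrable_mul_jacobiWeight {α : ℝ} (h0 : 0 < α) (h2 : α < 2) {f : ℝ → ℝ}
    (hf : ContinuousOn f (Set.Icc 0 1)) :
    IntervalIntegrable (fun t => f t * jacobiWeight α t) volume 0 1 :=
  (intervalIntegrable_jacobiWeight h0 h2).continuousOn_mul (by rwa [Set.uIcc_of_le zero_le_one])

theorem intervalIntegrable_eval_mul_jacobiWeight {α : ℝ} (h0 : 0 < α) (h2 : α < 2)
    (p : Polynomial ℝ) :
    IntervalIntegrable (fun t => p.eval t * jacobiWeight α t) volume 0 1 :=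
  intervalIntegrable_mul_jacobiWeight h0 h2 p.continuousOn

theorem jacobiWeight_pos (α : ℝ) {t : ℝ} (ht : t ∈ Set.Ioo (0 : ℝ) 1) : 0 < jacobiWeight α t :=
  mul_pos (Real.rpow_pos_of_pos ht.1 _) (Real.rpow_pos_of_pos (sub_pos.2 ht.2) _)

theorem jacobiWeight_nonneg (α : ℝ) {t : ℝ} (ht : t ∈ Set.Icc (0 : ℝ) 1) :
    0 ≤ jacobiWeight α t :=
  mul_nonneg (Real.rpow_nonneg ht.1 _) (Real.rpow_nonneg (sub_nonneg.2 ht.2) _)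

/-- The integrand is nonnegative and vanishes inside (0,1) only at the finitely many roots of `p`, a
null set. All positivity and orthogonality arguments below rest on this. -/
theorem integral_eval_mul_jacobiWeight_pos {α : ℝ} (h0 : 0 < α) (h2 : α < 2)
    {p : Polynomial ℝ} (hp : p ≠ 0) (hnn : ∀ t ∈ Set.Icc (0 : ℝ) 1, 0 ≤ p.eval t) :
    0 < ∫ t in (0 : ℝ)..1, p.eval t * jacobiWeight α t := by
  rw [intervalIntegral.integral_pos_iff_support_of_nonneg_ae' _
    (intervalIntegrable_eval_mul_jacobiWeight h0 h2 p)]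
  · refine ⟨zero_lt_one, ?_⟩
    have hsub : Set.Ioo (0 : ℝ) 1 \ (p.roots.toFinset : Set ℝ) ⊆
        (Function.support fun t => p.eval t * jacobiWeight α t) ∩ Set.Ioc 0 1 := by
      rintro t ⟨ht, htr⟩
      refine ⟨?_, Set.Ioo_subset_Ioc_self ht⟩
      rw [Function.mem_support]
      refine mul_ne_zero (fun h => htr ?_) (jacobiWeight_pos α ht).ne'
      simpa [hp] using h
    refine lt_of_lt_of_le ?_ (measure_mono hsub)
    rw [measure_sdiff_null (p.roots.toFinset.finite_toSet.measure_zero volume)]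
    simp
  · rw [Set.uIoc_of_le zero_le_one]
    refine (ae_restrict_iff' measurableSet_Ioc).2 (ae_of_all _ fun t ht => ?_)
    exact mul_nonneg (hnn t ⟨ht.1.le, ht.2⟩) (jacobiWeight_nonneg α ⟨ht.1.le, ht.2⟩)

/-! ### The integral representation of r^α s^(1-α). -/

/-- Change of variables along the Möbius transformation `u ↦ R u / (1 - u + R u)` of `[0, 1]`. -/
theorem integral_moebius {R : ℝ} (hR : 0 < R) (g : ℝ → ℝ) :
    ∫ t in (0 : ℝ)..1, g t =
      ∫ u in (0 : ℝ)..1, R / (1 - u + R * u) ^ 2 * g (R * u / (1 - u + R * u)) := by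
  have hE : ∀ u ∈ Set.Ioo (0 : ℝ) 1, 0 < 1 - u + R * u := fun u hu =>
    add_pos (sub_pos.2 hu.2) (mul_pos hR hu.1)
  have himage : (fun u => R * u / (1 - u + R * u)) '' Set.Ioo 0 1 = Set.Ioo 0 1 := by
    apply Set.Subset.antisymm
    · rintro _ ⟨u, hu, rfl⟩
      have := hE u hu
      refine ⟨div_pos (mul_pos hR hu.1) this, (div_lt_one this).2 ?_⟩
      linarith [hu.2]
    · intro t ht
      have hD : 0 < R * (1 - t) + t := add_pos (mul_pos hR (sub_pos.2 ht.2)) ht.1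
      refine ⟨t / (R * (1 - t) + t), ⟨div_pos ht.1 hD, (div_lt_one hD).2 ?_⟩, ?_⟩
      · nlinarith [mul_pos hR (sub_pos.2 ht.2)]
      · have : 1 - t / (R * (1 - t) + t) + R * (t / (R * (1 - t) + t)) =
            R / (R * (1 - t) + t) := by field_simp; ring
        simp only [this]
        field_simp
  have hderiv : ∀ u ∈ Set.Ioo (0 : ℝ) 1, HasDerivWithinAt (fun u => R * u / (1 - u + R * u))
      (R / (1 - u + R * u) ^ 2) (Set.Ioo 0 1) u := by
    intro u hu
    have h1 : HasDerivAt (fun u : ℝ => R * u) R u := by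
      simpa using (hasDerivAt_id u).const_mul R
    have h2 : HasDerivAt (fun u : ℝ => 1 - u + R * u) (-1 + R) u := by
      exact ((hasDerivAt_id u).const_sub 1).add h1
    have h3 := (h1.div h2 (hE u hu).ne').hasDerivWithinAt (s := Set.Ioo 0 1)
    refine h3.congr_deriv ?_
    congr 1
    ring
  have hinj : Set.InjOn (fun u => R * u / (1 - u + R * u)) (Set.Ioo 0 1) := by
    intro u hu v hv huv
    have h1 := hE u hu
    have h2 := hE v hv
    simp only at huv
    rw [div_eq_div_iff h1.ne' h2.ne'] at huv
    have : R * (u - v) = 0 := by linear_combination huv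
    rcases mul_eq_zero.1 this with h | h
    · exact absurd h hR.ne'
    · linarith
  rw [intervalIntegral.integral_of_le zero_le_one, intervalIntegral.integral_of_le zero_le_one,
    integral_Ioc_eq_integral_Ioo, integral_Ioc_eq_integral_Ioo]
  conv_lhs => rw [← himage]
  rw [integral_image_eq_integral_abs_deriv_smul measurableSet_Ioo hderiv hinj]
  refine setIntegral_congr_fun measurableSet_Ioo fun u hu => ?_
  simp only [smul_eq_mul]
  rw [abs_of_pos (div_pos hR (pow_pos (hE u hu) 2))]

theorem intervalIntegral_congr_Ioo {f g : ℝ → ℝ} (h : ∀ t ∈ Set.Ioo (0 : ℝ) 1, f t = g t) :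
    ∫ t in (0 : ℝ)..1, f t = ∫ t in (0 : ℝ)..1, g t := by
  rw [intervalIntegral.integral_of_le zero_le_one, intervalIntegral.integral_of_le zero_le_one,
    integral_Ioc_eq_integral_Ioo, integral_Ioc_eq_integral_Ioo]
  exact setIntegral_congr_fun measurableSet_Ioo h

theorem denominator_pos {R t : ℝ} (hR : 0 < R) (ht : t ∈ Set.Icc (0 : ℝ) 1) :
    0 < R + t * (1 - R) := by
  rcases ht with ⟨h0, h1⟩
  rcases h1.eq_or_lt with rfl | h1
  · linarith
  · nlinarith [mul_pos hR (sub_pos.2 h1)]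

theorem continuousOn_inv_denominator {R : ℝ} (hR : 0 < R) :
    ContinuousOn (fun t : ℝ => (R + t * (1 - R))⁻¹) (Set.Icc 0 1) :=
  ContinuousOn.inv₀ (by fun_prop) fun _ ht => (denominator_pos hR ht).ne'

/-- The effect of the Möbius transformation on a power of `t / (1 - t)`. -/
theorem moebius_rpow {R u : ℝ} (hR : 0 < R) (hu : u ∈ Set.Ioo (0 : ℝ) 1) (a : ℝ) :
    (R * u / (1 - u + R * u)) ^ a * (1 - R * u / (1 - u + R * u)) ^ (-a) =
      R ^ a * (u ^ a * (1 - u) ^ (-a)) := by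
  have hE : 0 < 1 - u + R * u := add_pos (sub_pos.2 hu.2) (mul_pos hR hu.1)
  have h1 : 1 - R * u / (1 - u + R * u) = (1 - u) / (1 - u + R * u) := by field_simp; ring
  have hu1 := sub_pos.2 hu.2
  rw [h1, Real.div_rpow (mul_pos hR hu.1).le hE.le, Real.div_rpow hu1.le hE.le,
    Real.mul_rpow hR.le hu.1.le, Real.rpow_neg hE.le]
  have := (Real.rpow_pos_of_pos hE a).ne'
  generalize (1 - u + R * u) ^ a = E at *
  field_simp

/-- Writing D = R + t(1-R), one has R(1-R)(1-t)/D = R/D - R. Splitting one factor 1-t off the weight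
leaves t^(α-1)(1-t)^(-α), still integrable for α < 1. The Möbius substitution then turns the R/D
term into R^α times a Beta integral. -/
theorem integral_rational_mul_jacobiWeight_of_lt_one {α R : ℝ} (h0 : 0 < α) (h1 : α < 1)
    (hR : 0 < R) :
    ∫ t in (0 : ℝ)..1, R * (1 - R) / (R + t * (1 - R)) * jacobiWeight α t =
      (R ^ α - R) * (Real.pi / Real.sin (α * Real.pi)) := by
  have hB := integral_betaIntegrand_one_sub h0 h1
  have hint : IntervalIntegrable (fun t : ℝ => t ^ (α - 1) * (1 - t) ^ (-α)) volume 0 1 := by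
    have h := intervalIntegrable_betaIntegrand h0 (sub_pos.2 h1)
    rwa [show 1 - α - 1 = -α by ring] at h
  have hint' : IntervalIntegrable (fun t : ℝ => R * (R + t * (1 - R))⁻¹ *
      (t ^ (α - 1) * (1 - t) ^ (-α))) volume 0 1 :=
    hint.continuousOn_mul (by
      rw [Set.uIcc_of_le zero_le_one]
      exact (continuousOn_inv_denominator hR).const_smul R)
  have h₁ : ∫ t in (0 : ℝ)..1, R * (R + t * (1 - R))⁻¹ * (t ^ (α - 1) * (1 - t) ^ (-α)) =
      R ^ α * ∫ t in (0 : ℝ)..1, t ^ (α - 1) * (1 - t) ^ (-α) := by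
    rw [integral_moebius hR, ← intervalIntegral.integral_const_mul]
    refine intervalIntegral_congr_Ioo fun u hu => ?_
    have hE : 0 < 1 - u + R * u := add_pos (sub_pos.2 hu.2) (mul_pos hR hu.1)
    have hu1 := sub_pos.2 hu.2
    -- `moebius_rpow` needs opposite exponents, so a factor (1-x)⁻¹ is split off below.
    have hm := moebius_rpow hR hu (α - 1)
    have hx : 1 - R * u / (1 - u + R * u) = (1 - u) / (1 - u + R * u) := by field_simp; ring
    have hxp : 0 < 1 - R * u / (1 - u + R * u) := by rw [hx]; positivity
    have e1 : (1 - R * u / (1 - u + R * u)) ^ (-α) =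
        (1 - R * u / (1 - u + R * u)) ^ (-(α - 1)) * ((1 - u) / (1 - u + R * u))⁻¹ := by
      rw [← hx, ← Real.rpow_neg_one, ← Real.rpow_add hxp]; congr 1; ring
    have e2 : (1 - u) ^ (-α) = (1 - u) ^ (-(α - 1)) * (1 - u)⁻¹ := by
      rw [← Real.rpow_neg_one, ← Real.rpow_add hu1]; congr 1; ring
    have e3 : R ^ α = R ^ (α - 1) * R := by
      rw [← Real.rpow_add_one hR.ne']; congr 1; ring
    have hD : R + R * u / (1 - u + R * u) * (1 - R) = R / (1 - u + R * u) := by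
      field_simp; ring
    rw [hD, e1, ← mul_assoc ((R * u / (1 - u + R * u)) ^ (α - 1)), hm, e2, e3]
    field_simp
  have h₂ : ∫ t in (0 : ℝ)..1, R * (1 - R) / (R + t * (1 - R)) * jacobiWeight α t =
      ∫ t in (0 : ℝ)..1, (R * (R + t * (1 - R))⁻¹ * (t ^ (α - 1) * (1 - t) ^ (-α)) -
        R * (t ^ (α - 1) * (1 - t) ^ (-α))) := by
    refine intervalIntegral_congr_Ioo fun t ht => ?_
    have hD := denominator_pos hR (Set.Ioo_subset_Icc_self ht)
    have ht1 := sub_pos.2 ht.2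
    have e1 : (1 - t) ^ (1 - α) = (1 - t) * (1 - t) ^ (-α) := by
      rw [sub_eq_add_neg 1 α, Real.rpow_add ht1, Real.rpow_one]
    rw [jacobiWeight, e1, div_eq_mul_inv]
    linear_combination (-(R * t ^ (α - 1) * (1 - t) ^ (-α))) * mul_inv_cancel₀ hD.ne'
  rw [h₂, intervalIntegral.integral_sub hint' (hint.const_mul R), h₁,
    intervalIntegral.integral_const_mul, hB]
  ring

/-- For α > 1 the factor t is split off instead: R(1-R)t/D = R - R²/D with D = R + t(1-R),
integrated against t^(α-2)(1-t)^(1-α). This is the Beta integral at α-1, whose sine has the opposite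
sign and compensates the reversed order of the difference. -/
theorem integral_rational_mul_jacobiWeight_of_one_lt {α R : ℝ} (h1 : 1 < α) (h2 : α < 2)
    (hR : 0 < R) :
    ∫ t in (0 : ℝ)..1, R * (1 - R) / (R + t * (1 - R)) * jacobiWeight α t =
      (R ^ α - R) * (Real.pi / Real.sin (α * Real.pi)) := by
  have hB := integral_betaIntegrand_one_sub (a := α - 1) (by linarith) (by linarith)
  have hs : Real.sin ((α - 1) * Real.pi) = -Real.sin (α * Real.pi) := by
    rw [sub_mul, one_mul, Real.sin_sub_pi]
  have hint : IntervalIntegrable (fun t : ℝ => t ^ (α - 1 - 1) * (1 - t) ^ (-(α - 1)))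
      volume 0 1 := by
    have h := intervalIntegrable_betaIntegrand (a := α - 1) (b := 1 - (α - 1)) (by linarith)
      (by linarith)
    rwa [show 1 - (α - 1) - 1 = -(α - 1) by ring] at h
  have hint' : IntervalIntegrable (fun t : ℝ => R * R * (R + t * (1 - R))⁻¹ *
      (t ^ (α - 1 - 1) * (1 - t) ^ (-(α - 1)))) volume 0 1 :=
    hint.continuousOn_mul (by
      rw [Set.uIcc_of_le zero_le_one]
      exact (continuousOn_inv_denominator hR).const_smul (R * R))
  have h₁ : ∫ t in (0 : ℝ)..1, R * R * (R + t * (1 - R))⁻¹ *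
      (t ^ (α - 1 - 1) * (1 - t) ^ (-(α - 1))) =
      R ^ α * ∫ t in (0 : ℝ)..1, t ^ (α - 1 - 1) * (1 - t) ^ (-(α - 1)) := by
    rw [integral_moebius hR, ← intervalIntegral.integral_const_mul]
    refine intervalIntegral_congr_Ioo fun u hu => ?_
    have hE : 0 < 1 - u + R * u := add_pos (sub_pos.2 hu.2) (mul_pos hR hu.1)
    have hu0 := hu.1
    have hm := moebius_rpow hR hu (α - 1)
    have hxp : 0 < R * u / (1 - u + R * u) := by positivity
    have e1 : (R * u / (1 - u + R * u)) ^ (α - 1 - 1) =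
        (R * u / (1 - u + R * u))⁻¹ * (R * u / (1 - u + R * u)) ^ (α - 1) := by
      rw [← Real.rpow_neg_one, ← Real.rpow_add hxp]; congr 1; ring
    have e2 : u ^ (α - 1 - 1) = u⁻¹ * u ^ (α - 1) := by
      rw [← Real.rpow_neg_one, ← Real.rpow_add hu0]; congr 1; ring
    have e3 : R ^ α = R ^ (α - 1) * R := by
      rw [← Real.rpow_add_one hR.ne']; congr 1; ring
    have hD : R + R * u / (1 - u + R * u) * (1 - R) = R / (1 - u + R * u) := by
      field_simp; ring
    rw [hD, e1, mul_assoc (R * u / (1 - u + R * u))⁻¹, hm, e2, e3]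
    field_simp
  have h₂ : ∫ t in (0 : ℝ)..1, R * (1 - R) / (R + t * (1 - R)) * jacobiWeight α t =
      ∫ t in (0 : ℝ)..1, (R * (t ^ (α - 1 - 1) * (1 - t) ^ (-(α - 1))) -
        R * R * (R + t * (1 - R))⁻¹ * (t ^ (α - 1 - 1) * (1 - t) ^ (-(α - 1)))) := by
    refine intervalIntegral_congr_Ioo fun t ht => ?_
    have hD := denominator_pos hR (Set.Ioo_subset_Icc_self ht)
    have ht0 := ht.1
    have e1 : t ^ (α - 1) = t * t ^ (α - 1 - 1) := by
      rw [mul_comm, ← Real.rpow_add_one ht0.ne']; congr 1; ring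
    rw [jacobiWeight, e1, neg_sub, div_eq_mul_inv]
    linear_combination (R * t ^ (α - 1 - 1) * (1 - t) ^ (1 - α)) * mul_inv_cancel₀ hD.ne'
  rw [h₂, intervalIntegral.integral_sub (hint.const_mul R) hint', h₁,
    intervalIntegral.integral_const_mul, hB, hs]
  ring

/-- Both sides are homogeneous of degree one in (r, s), so dividing by s reduces to R = r/s. -/
theorem integral_rational_mul_jacobiWeight {α r s : ℝ}
    (hα : α ∈ Set.Ioo (0 : ℝ) 1 ∪ Set.Ioo (1 : ℝ) 2) (hr : 0 < r) (hs : 0 < s) :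
    r + Real.sin (α * Real.pi) / Real.pi *
      ∫ t in (0 : ℝ)..1, r * (s - r) / (r + t * (s - r)) * jacobiWeight α t =
      r ^ α * s ^ (1 - α) := by
  have hsin : Real.sin (α * Real.pi) ≠ 0 := by
    rcases hα with h | h
    · exact (Real.sin_pos_of_pos_of_lt_pi (mul_pos h.1 Real.pi_pos)
        (by nlinarith [Real.pi_pos, h.2])).ne'
    · have : 0 < Real.sin ((α - 1) * Real.pi) :=
        Real.sin_pos_of_pos_of_lt_pi (mul_pos (sub_pos.2 h.1) Real.pi_pos)
          (by nlinarith [Real.pi_pos, h.2])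
      rw [sub_mul, one_mul, Real.sin_sub_pi] at this
      exact (neg_pos.1 this).ne
  have key : ∀ R : ℝ, 0 < R →
      ∫ t in (0 : ℝ)..1, R * (1 - R) / (R + t * (1 - R)) * jacobiWeight α t =
      (R ^ α - R) * (Real.pi / Real.sin (α * Real.pi)) := fun R hR => hα.elim
    (fun h => integral_rational_mul_jacobiWeight_of_lt_one h.1 h.2 hR)
    (fun h => integral_rational_mul_jacobiWeight_of_one_lt h.1 h.2 hR)
  have hscale : ∫ t in (0 : ℝ)..1, r * (s - r) / (r + t * (s - r)) * jacobiWeight α t =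
      s * ∫ t in (0 : ℝ)..1, r / s * (1 - r / s) / (r / s + t * (1 - r / s)) *
        jacobiWeight α t := by
    rw [← intervalIntegral.integral_const_mul]
    refine intervalIntegral_congr_Ioo fun t ht => ?_
    have h1 := denominator_pos (div_pos hr hs) (Set.Ioo_subset_Icc_self ht)
    have h2 : r + t * (s - r) = s * (r / s + t * (1 - r / s)) := by field_simp
    have h3 : s - r = s * (1 - r / s) := by field_simp
    rw [h2, h3]
    generalize r / s + t * (1 - r / s) = D at *
    field_simp
  rw [hscale, key _ (div_pos hr hs), Real.div_rpow hr.le hs.le, sub_eq_add_neg 1 α,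
    Real.rpow_add hs, Real.rpow_neg hs.le, Real.rpow_one]
  have := (Real.rpow_pos_of_pos hs α).ne'
  have := Real.pi_pos.ne'
  field_simp
  ring

/-! ### Existence of the quadrature rule. -/

open Polynomial in
/-- The integral of a polynomial against the Jacobi-type weight. -/
noncomputable def jacobiFunctional (α : ℝ) (h0 : 0 < α) (h2 : α < 2) : ℝ[X] →ₗ[ℝ] ℝ where
  toFun p := ∫ s in (0 : ℝ)..1, p.eval s * jacobiWeight α s
  map_add' p q := by
    rw [← intervalIntegral.integral_add (intervalIntegrable_eval_mul_jacobiWeight h0 h2 p)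
      (intervalIntegrable_eval_mul_jacobiWeight h0 h2 q)]
    simp only [eval_add, add_mul]
  map_smul' c p := by
    rw [RingHom.id_apply, smul_eq_mul, ← intervalIntegral.integral_const_mul]
    simp only [eval_smul, smul_eq_mul, mul_assoc]

section Functional

open Polynomial

variable {α : ℝ} (h0 : 0 < α) (h2 : α < 2)

theorem jacobiFunctional_pos {p : ℝ[X]} (hp : p ≠ 0)
    (hnn : ∀ t ∈ Set.Icc (0 : ℝ) 1, 0 ≤ p.eval t) : 0 < jacobiFunctional α h0 h2 p :=
  integral_eval_mul_jacobiWeight_pos h0 h2 hp hnn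

theorem one_sub_X_ne_zero : (1 - X : ℝ[X]) ≠ 0 := fun h => by
  simpa using congrArg (eval 0) h

/-- A nonzero polynomial `P` of degree at most `n`, orthogonal to all polynomials of smaller degree
with respect to `(1 - t)` times the Jacobi-type weight. -/
theorem exists_orthogonal_polynomial (n : ℕ) :
    ∃ P : ℝ[X], P ≠ 0 ∧ P.natDegree ≤ n ∧
      ∀ q : ℝ[X], q.natDegree < n → jacobiFunctional α h0 h2 ((1 - X) * (P * q)) = 0 := by
  -- Orthogonality to 1, X, …, X^(n-1) is n linear conditions on a space of dimension n+1, so `F`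
  -- has a nonzero kernel vector.
  let F : degreeLT ℝ (n + 1) →ₗ[ℝ] (Fin n → ℝ) := LinearMap.pi fun i =>
    (jacobiFunctional α h0 h2 ∘ₗ LinearMap.mulLeft ℝ (1 - X : ℝ[X]) ∘ₗ
      LinearMap.mulRight ℝ (X ^ (i : ℕ) : ℝ[X])) ∘ₗ (degreeLT ℝ (n + 1)).subtype
  have : FiniteDimensional ℝ (degreeLT ℝ (n + 1)) :=
    Module.Finite.equiv (degreeLTEquiv ℝ (n + 1)).symm
  have hker : F.ker ≠ ⊥ := by
    apply LinearMap.ker_ne_bot_of_finrank_lt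
    rw [(degreeLTEquiv ℝ (n + 1)).finrank_eq]
    simp
  obtain ⟨⟨P, hPdeg⟩, hPker, hP0⟩ := Submodule.exists_mem_ne_zero_of_ne_bot hker
  have hP : P ≠ 0 := fun h => hP0 (Subtype.ext h)
  refine ⟨P, hP, ?_, fun q hq => ?_⟩
  · rw [mem_degreeLT] at hPdeg
    have := (natDegree_lt_iff_degree_lt hP).2 hPdeg
    omega
  · have hmono : ∀ i < n, jacobiFunctional α h0 h2 ((1 - X) * (P * X ^ i)) = 0 := by
      intro i hi
      simpa [F] using congrFun (LinearMap.mem_ker.1 hPker) ⟨i, hi⟩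
    have hexp : (1 - X) * (P * q) =
        ∑ i ∈ Finset.range n, q.coeff i • ((1 - X) * (P * X ^ i)) := by
      conv_lhs => rw [q.as_sum_range' n hq]
      rw [Finset.mul_sum, Finset.mul_sum]
      refine Finset.sum_congr rfl fun i _ => ?_
      rw [← smul_X_eq_monomial]
      simp only [mul_smul_comm]
    rw [hexp, map_sum]
    refine Finset.sum_eq_zero fun i hi => ?_
    rw [map_smul, hmono i (Finset.mem_range.1 hi), smul_zero]

variable {h0 h2} {P : ℝ[X]} {n : ℕ}

/-- Testing orthogonality against Q itself gives the integral of (1-X)gQ², which is strictly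
positive. Degree, splitting, simplicity and location of the roots are all read off from this
contradiction. -/
theorem not_nonneg_factor_of_orthogonal (hP : P ≠ 0)
    (horth : ∀ q : ℝ[X], q.natDegree < n → jacobiFunctional α h0 h2 ((1 - X) * (P * q)) = 0)
    {g Q : ℝ[X]} (hfac : P = g * Q) (hQ : Q.natDegree < n)
    (hg : ∀ t ∈ Set.Icc (0 : ℝ) 1, 0 ≤ g.eval t) : False := by
  have hQ0 : Q ≠ 0 := right_ne_zero_of_mul (hfac ▸ hP)
  have hne : (1 - X) * (P * Q) ≠ 0 := mul_ne_zero one_sub_X_ne_zero (mul_ne_zero hP hQ0)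
  refine (jacobiFunctional_pos h0 h2 hne fun t ht => ?_).ne' (horth Q hQ)
  rw [hfac]
  simp only [eval_mul, eval_sub, eval_one, eval_X]
  rw [mul_assoc]
  exact mul_nonneg (sub_nonneg.2 ht.2) (mul_nonneg (hg t ht) (mul_self_nonneg _))

theorem natDegree_of_orthogonal (hP : P ≠ 0) (hdeg : P.natDegree ≤ n)
    (horth : ∀ q : ℝ[X], q.natDegree < n → jacobiFunctional α h0 h2 ((1 - X) * (P * q)) = 0) :
    P.natDegree = n := by
  by_contra h
  exact not_nonneg_factor_of_orthogonal hP horth (one_mul P).symm (by omega) (by simp)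

/-- A factor of positive degree of an orthogonal polynomial changes sign on `[0, 1]`. -/
theorem exists_neg_of_dvd_orthogonal (hP : P ≠ 0) (hdeg : P.natDegree ≤ n)
    (horth : ∀ q : ℝ[X], q.natDegree < n → jacobiFunctional α h0 h2 ((1 - X) * (P * q)) = 0)
    {g : ℝ[X]} (hg : g ∣ P) (hgdeg : 0 < g.natDegree) :
    ∃ t ∈ Set.Icc (0 : ℝ) 1, g.eval t < 0 := by
  by_contra! h
  obtain ⟨Q, hQ⟩ := hg
  have hg0 : g ≠ 0 := left_ne_zero_of_mul (hQ ▸ hP)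
  have hQ0 : Q ≠ 0 := right_ne_zero_of_mul (hQ ▸ hP)
  have := natDegree_mul hg0 hQ0
  rw [← hQ] at this
  exact not_nonneg_factor_of_orthogonal hP horth hQ (by omega) h

/-- Each irreducible factor and its negative take a negative value, so the factor has a real root
and is linear. -/
theorem splits_of_orthogonal (hP : P ≠ 0) (hdeg : P.natDegree ≤ n)
    (horth : ∀ q : ℝ[X], q.natDegree < n → jacobiFunctional α h0 h2 ((1 - X) * (P * q)) = 0) :
    P.Splits := by
  obtain ⟨u, hu⟩ := UniqueFactorizationMonoid.factors_prod hP
  rw [← hu]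
  refine (Splits.multisetProd fun g hgf => Splits.of_degree_eq_one ?_).mul u.isUnit.splits
  have hg := UniqueFactorizationMonoid.irreducible_of_factor g hgf
  have hgP := UniqueFactorizationMonoid.dvd_of_mem_factors hgf
  have hpos : 0 < g.natDegree := hg.natDegree_pos
  obtain ⟨s, -, hs⟩ := exists_neg_of_dvd_orthogonal hP hdeg horth hgP hpos
  obtain ⟨t, -, ht⟩ := exists_neg_of_dvd_orthogonal hP hdeg horth ((neg_dvd).2 hgP)
    (by rwa [natDegree_neg])
  rw [eval_neg, neg_lt_zero] at ht
  obtain ⟨x, hx⟩ := mem_range_of_exists_le_of_exists_ge g.continuous ⟨s, hs.le⟩ ⟨t, ht.le⟩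
  exact degree_eq_one_of_irreducible_of_root hg hx

theorem nodup_roots_of_orthogonal (hP : P ≠ 0) (hdeg : P.natDegree ≤ n)
    (horth : ∀ q : ℝ[X], q.natDegree < n → jacobiFunctional α h0 h2 ((1 - X) * (P * q)) = 0) :
    P.roots.Nodup := by
  rw [Multiset.nodup_iff_count_le_one]
  intro a
  by_contra! h
  rw [count_roots] at h
  -- A multiple root would give the factor (X-a)², which never changes sign.
  have hdvd := (le_rootMultiplicity_iff hP (a := a) (n := 2)).1 h
  obtain ⟨t, -, ht⟩ := exists_neg_of_dvd_orthogonal hP hdeg horth hdvd (by simp)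
  simp only [eval_pow] at ht
  exact absurd ht (not_lt.2 (sq_nonneg _))

theorem root_lt_one_of_orthogonal (hP : P ≠ 0) (hdeg : P.natDegree ≤ n)
    (horth : ∀ q : ℝ[X], q.natDegree < n → jacobiFunctional α h0 h2 ((1 - X) * (P * q)) = 0)
    {a : ℝ} (ha : P.IsRoot a) : a < 1 := by
  obtain ⟨t, ht, hneg⟩ := exists_neg_of_dvd_orthogonal hP hdeg horth
    ((neg_dvd).2 (dvd_iff_isRoot.2 ha)) (by rw [natDegree_neg, natDegree_X_sub_C]; exact one_pos)
  simp only [eval_neg, eval_sub, eval_X, eval_C] at hneg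
  linarith [ht.2]

end Functional

-- The nodes are the n roots of the orthogonal polynomial P together with 1, and the weights are the
-- integrals of the Lagrange basis. Division by G = (1-X)P proves exactness: the quotient part
-- integrates to 0 by orthogonality, and the remainder is its own interpolant.
open Polynomial in
theorem exists_isGaussRadauJacobi {α : ℝ} (h0 : 0 < α) (h2 : α < 2) (n : ℕ) :
    ∃ t w : Fin (n + 1) → ℝ, IsGaussRadauJacobi α (n + 1) t w := by
  obtain ⟨P, hP, hdeg, horth⟩ := exists_orthogonal_polynomial h0 h2 n
  have hPn := natDegree_of_orthogonal hP hdeg horth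
  have hlt : ∀ a ∈ P.roots.toFinset, a < 1 := fun a ha =>
    root_lt_one_of_orthogonal hP hdeg horth (isRoot_of_mem_roots (Multiset.mem_toFinset.1 ha))
  have hcard : (insert 1 P.roots.toFinset).card = n + 1 := by
    rw [Finset.card_insert_of_notMem fun h => lt_irrefl _ (hlt 1 h),
      Multiset.toFinset_card_of_nodup (nodup_roots_of_orthogonal hP hdeg horth),
      splits_iff_card_roots.1 (splits_of_orthogonal hP hdeg horth), hPn]
  let t : Fin (n + 1) → ℝ := (insert 1 P.roots.toFinset).orderEmbOfFin hcard
  have hmono : StrictMono t := ((insert 1 P.roots.toFinset).orderEmbOfFin hcard).strictMono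
  have hmem : ∀ i, t i = 1 ∨ P.IsRoot (t i) := fun i => by
    have := Finset.orderEmbOfFin_mem (insert 1 P.roots.toFinset) hcard i
    rw [Finset.mem_insert, Multiset.mem_toFinset] at this
    exact this.imp_right isRoot_of_mem_roots
  have hle : ∀ i, t i ≤ 1 := fun i => (hmem i).elim le_of_eq
    fun h => (root_lt_one_of_orthogonal hP hdeg horth h).le
  let Λ := jacobiFunctional α h0 h2
  refine ⟨t, fun i => Λ (Lagrange.basis Finset.univ t i), hmono, fun i hi => ?_, fun p hp => ?_⟩
  · obtain ⟨j, hj⟩ : (1 : ℝ) ∈ Set.range t := by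
      have := Finset.range_orderEmbOfFin (insert 1 P.roots.toFinset) hcard
      rw [show Set.range t = _ from this]
      simp
    refine le_antisymm (hle i) (hj ▸ hmono.monotone ?_)
    rw [Fin.le_def]
    omega
  · change Λ p = _
    set G : ℝ[X] := (1 - X) * P with hG
    have hG0 : G ≠ 0 := mul_ne_zero one_sub_X_ne_zero hP
    have hXdeg : (1 - X : ℝ[X]).natDegree = 1 := by
      rw [← natDegree_neg, neg_sub, ← C_1, natDegree_X_sub_C]
    have hGdeg : G.natDegree = n + 1 := by
      rw [hG, natDegree_mul one_sub_X_ne_zero hP, hXdeg, hPn, add_comm]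
    have hGroot : ∀ i, G.eval (t i) = 0 := fun i => by
      rw [hG, eval_mul]
      rcases hmem i with h | h
      · simp [h]
      · rw [h.eq_zero, mul_zero]
    have hdivmod : G * (p / G) + p % G = p := EuclideanDomain.div_add_mod p G
    have hΛdiv : Λ (G * (p / G)) = 0 := by
      -- A zero quotient is treated apart because for n = 0 no polynomial has `natDegree` below n.
      -- Otherwise deg p ≤ 2n and deg G = n+1 leave degree at most n-1.
      by_cases hD : p / G = 0
      · rw [hD, mul_zero, map_zero]
      · rw [hG, mul_assoc]
        refine horth _ ?_
        have hle : G.degree ≤ p.degree := by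
          by_contra! hlt
          exact hD ((Polynomial.div_eq_zero_iff hG0).2 hlt)
        have h := degree_add_div hG0 hle
        have hp0 : p ≠ 0 := fun h => hD (by rw [h, EuclideanDomain.zero_div])
        rw [degree_eq_natDegree hG0, degree_eq_natDegree hD, degree_eq_natDegree hp0] at h
        have h' : G.natDegree + (p / G).natDegree = p.natDegree := by exact_mod_cast h
        rw [← hG]
        omega
    have heval : ∀ i, p.eval (t i) = (p % G).eval (t i) := fun i => by
      conv_lhs => rw [← hdivmod]
      rw [eval_add, eval_mul, hGroot, zero_mul, zero_add]
    have hrem : p % G = ∑ i, C (p.eval (t i)) * Lagrange.basis Finset.univ t i := by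
      rw [← Lagrange.interpolate_apply]
      have := Lagrange.eq_interpolate (s := Finset.univ) (v := t) (f := p % G)
        (hmono.injective.injOn) (by
          have := degree_mod_lt p hG0
          rw [degree_eq_natDegree hG0, hGdeg] at this
          simpa using this)
      simpa only [← heval] using this
    conv_lhs => rw [← hdivmod]
    rw [map_add, hΛdiv, zero_add, hrem, map_sum]
    refine Finset.sum_congr rfl fun i _ => ?_
    rw [← smul_eq_C_mul, map_smul, smul_eq_mul, mul_comm]

/-! ### Properties of every rule: positivity, sign of the error, convergence. -/

namespace IsGaussRadauJacobi

open Polynomial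

variable {α : ℝ} {n : ℕ} {t w : Fin (n + 1) → ℝ}

theorem apply_last (h : IsGaussRadauJacobi α (n + 1) t w) : t (Fin.last n) = 1 :=
  h.last_node _ (by simp)

theorem le_one (h : IsGaussRadauJacobi α (n + 1) t w) (i : Fin (n + 1)) : t i ≤ 1 :=
  h.apply_last ▸ h.strictMono.monotone (Fin.le_last i)

/-- Exactness collapses to the single term at i, so a suitable test polynomial isolates one weight.
-/
theorem weight_mul_eval_pos (h : IsGaussRadauJacobi α (n + 1) t w) (h0 : 0 < α) (h2 : α < 2)
    (i : Fin (n + 1)) {p : ℝ[X]} (hp : p ≠ 0) (hdeg : p.natDegree ≤ 2 * n)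
    (hnn : ∀ s ∈ Set.Icc (0 : ℝ) 1, 0 ≤ p.eval s) (hz : ∀ j, j ≠ i → p.eval (t j) = 0) :
    0 < w i * p.eval (t i) := by
  have hpos := integral_eval_mul_jacobiWeight_pos h0 h2 hp hnn
  rw [h.exact p (by omega), Finset.sum_eq_single i] at hpos
  · exact hpos
  · intro j _ hj
    rw [hz j hj, mul_zero]
  · simp

theorem weight_last_pos (h : IsGaussRadauJacobi α (n + 1) t w) (h0 : 0 < α) (h2 : α < 2) :
    0 < w (Fin.last n) := by
  let N := Lagrange.nodal (Finset.univ.erase (Fin.last n)) t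
  have hN : N ≠ 0 := Lagrange.nodal_ne_zero
  have hpos := h.weight_mul_eval_pos h0 h2 (Fin.last n) (p := N ^ 2) (pow_ne_zero 2 hN)
    (by
      rw [natDegree_pow, Lagrange.natDegree_nodal, Finset.card_erase_of_mem (Finset.mem_univ _)]
      simp)
    (fun s _ => by rw [eval_pow]; exact sq_nonneg _)
    (fun j hj => by
      rw [eval_pow, Lagrange.eval_nodal_at_node (Finset.mem_erase.2 ⟨hj, Finset.mem_univ _⟩)]
      simp)
  rw [eval_pow] at hpos
  exact pos_of_mul_pos_left hpos (sq_nonneg _)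

/-- With N vanishing at the other nodes except 1, test p = (1-X)N² and Xp, of degrees 2n-1 and 2n.
The first gives w_i p(t_i) > 0 and the second t_i w_i p(t_i) > 0. Comparing them yields t_i > 0,
while p(t_i) ≥ 0 follows from t_i ≤ 1 alone. -/
theorem node_weight_pos_of_ne_last (h : IsGaussRadauJacobi α (n + 1) t w) (h0 : 0 < α)
    (h2 : α < 2) {i : Fin (n + 1)} (hi : i ≠ Fin.last n) : 0 < t i ∧ 0 < w i := by
  let N := Lagrange.nodal ((Finset.univ.erase (Fin.last n)).erase i) t
  have hN : N ≠ 0 := Lagrange.nodal_ne_zero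
  have hNdeg : N.natDegree + 1 = n := by
    rw [Lagrange.natDegree_nodal,
      Finset.card_erase_of_mem (Finset.mem_erase.2 ⟨hi, Finset.mem_univ _⟩),
      Finset.card_erase_of_mem (Finset.mem_univ _), Finset.card_univ, Fintype.card_fin]
    have := Fin.lt_last_iff_ne_last.2 hi
    rw [Fin.lt_def, Fin.val_last] at this
    omega
  have hNz : ∀ j, j ≠ i → (1 - t j) * N.eval (t j) ^ 2 = 0 := fun j hj => by
    by_cases hl : j = Fin.last n
    · rw [hl, h.apply_last, sub_self, zero_mul]
    · rw [Lagrange.eval_nodal_at_node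
        (Finset.mem_erase.2 ⟨hj, Finset.mem_erase.2 ⟨hl, Finset.mem_univ _⟩⟩)]
      simp
  have hXdeg : (1 - X : ℝ[X]).natDegree ≤ 1 := by
    rw [← natDegree_neg, neg_sub, ← C_1, natDegree_X_sub_C]
  have hdeg : ((1 - X : ℝ[X]) * N ^ 2).natDegree + 1 ≤ 2 * n := by
    have h1 := natDegree_mul_le (p := (1 - X : ℝ[X])) (q := N ^ 2)
    rw [natDegree_pow] at h1
    omega
  have hne : (1 - X : ℝ[X]) * N ^ 2 ≠ 0 := mul_ne_zero one_sub_X_ne_zero (pow_ne_zero 2 hN)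
  have hw := h.weight_mul_eval_pos h0 h2 i hne (by omega)
    (fun s hs => by
      simpa using mul_nonneg (sub_nonneg.2 hs.2) (sq_nonneg (N.eval s)))
    (fun j hj => by simpa using hNz j hj)
  have ht := h.weight_mul_eval_pos h0 h2 i (mul_ne_zero X_ne_zero hne)
    (by
      have h1 := natDegree_mul_le (p := (X : ℝ[X])) (q := (1 - X) * N ^ 2)
      rw [natDegree_X] at h1
      omega)
    (fun s hs => by
      simpa using mul_nonneg hs.1 (mul_nonneg (sub_nonneg.2 hs.2) (sq_nonneg (N.eval s))))
    (fun j hj => by rw [eval_mul]; exact mul_eq_zero_of_right _ (by simpa using hNz j hj))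
  rw [eval_mul, eval_X, mul_left_comm] at ht
  refine ⟨pos_of_mul_pos_left ht hw.le, pos_of_mul_pos_left hw ?_⟩
  simpa using mul_nonneg (sub_nonneg.2 (h.le_one i)) (sq_nonneg (N.eval (t i)))

theorem weight_pos (h : IsGaussRadauJacobi α (n + 1) t w) (h0 : 0 < α) (h2 : α < 2)
    (i : Fin (n + 1)) : 0 < w i := by
  by_cases hi : i = Fin.last n
  · exact hi ▸ h.weight_last_pos h0 h2
  · exact (h.node_weight_pos_of_ne_last h0 h2 hi).2

theorem node_mem (h : IsGaussRadauJacobi α (n + 1) t w) (h0 : 0 < α) (h2 : α < 2)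
    (i : Fin (n + 1)) : t i ∈ Set.Ioc (0 : ℝ) 1 := by
  refine ⟨?_, h.le_one i⟩
  by_cases hi : i = Fin.last n
  · rw [hi, h.apply_last]
    exact one_pos
  · exact (h.node_weight_pos_of_ne_last h0 h2 hi).1

theorem sum_weight (h : IsGaussRadauJacobi α (n + 1) t w) :
    ∑ i, w i = ∫ s in (0 : ℝ)..1, jacobiWeight α s := by
  have := h.exact 1 (by simp)
  simpa using this.symm

/-- For s ≠ r let a be the pole, and let q = (X-1)N² vanish doubly at all nodes but the last, where
it vanishes simply. Then r(q(a)-q)/(q(a)(X-a)) is a polynomial of degree at most 2n that agrees with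
the integrand f at the nodes and differs from it by f·q/q(a). This error is nonnegative on [0,1]
whatever the sign of s-r, and exactness converts that into the inequality. -/
theorem sum_rational_le_integral (h : IsGaussRadauJacobi α (n + 1) t w) (h0 : 0 < α)
    (h2 : α < 2) {r s : ℝ} (hr : 0 < r) (hs : 0 < s) :
    ∑ i, w i * (r * (s - r) / (r + t i * (s - r))) ≤
      ∫ u in (0 : ℝ)..1, r * (s - r) / (r + u * (s - r)) * jacobiWeight α u := by
  have hD : ∀ u ∈ Set.Icc (0 : ℝ) 1, 0 < r + u * (s - r) := fun u hu => by
    rcases hu.2.eq_or_lt with rfl | h1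
    · linarith
    · nlinarith [mul_pos hr (sub_pos.2 h1), mul_nonneg hu.1 hs.le]
  have hti : ∀ i, t i ∈ Set.Icc (0 : ℝ) 1 := fun i => Set.Ioc_subset_Icc_self (h.node_mem h0 h2 i)
  rcases eq_or_ne s r with rfl | hsr
  · simp
  have hx : s - r ≠ 0 := sub_ne_zero.2 hsr
  obtain ⟨a, hax⟩ : ∃ a : ℝ, a * (s - r) = -r := ⟨-r / (s - r), div_mul_cancel₀ _ hx⟩
  let N := Lagrange.nodal (Finset.univ.erase (Fin.last n)) t
  let q : ℝ[X] := (X - C 1) * N ^ 2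
  have hNa : N.eval a ≠ 0 := by
    refine Lagrange.eval_nodal_not_at_node fun i _ hi => ?_
    have := hD (t i) (hti i)
    rw [← hi, hax] at this
    linarith
  have hqa : q.eval a ≠ 0 := by
    have : a ≠ 1 := fun h => by rw [h] at hax; linarith
    simpa [q] using ⟨sub_ne_zero.2 this, hNa⟩
  have hqt : ∀ i, q.eval (t i) = 0 := fun i => by
    by_cases hl : i = Fin.last n
    · simp [q, hl, h.apply_last]
    · have := Lagrange.eval_nodal_at_node (v := t)
        (Finset.mem_erase.2 ⟨hl, Finset.mem_univ i⟩)
      simp only [q, N, eval_mul, eval_pow, this]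
      simp
  obtain ⟨p₀, hp₀⟩ : X - C a ∣ C (q.eval a) - q := dvd_iff_isRoot.2 (by simp)
  have hqdeg : q.natDegree ≤ 2 * n + 1 := by
    have h1 := natDegree_mul_le (p := (X - C 1 : ℝ[X])) (q := N ^ 2)
    rw [natDegree_pow, natDegree_X_sub_C, Lagrange.natDegree_nodal,
      Finset.card_erase_of_mem (Finset.mem_univ _), Finset.card_univ, Fintype.card_fin] at h1
    have : q.natDegree ≤ 1 + 2 * (n + 1 - 1) := h1
    omega
  have hp₀deg : p₀.natDegree ≤ 2 * n := by
    by_cases hp0 : p₀ = 0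
    · simp [hp0]
    · have h1 := natDegree_mul (X_sub_C_ne_zero a) hp0
      rw [← hp₀, natDegree_X_sub_C] at h1
      have h3 := natDegree_sub_le (C (q.eval a)) q
      rw [natDegree_C] at h3
      have : max 0 q.natDegree = q.natDegree := by simp
      omega
  let p : ℝ[X] := C (r / q.eval a) * p₀
  have hpdeg : p.natDegree ≤ 2 * n := (natDegree_C_mul_le _ _).trans hp₀deg
  have hdiff : ∀ u ∈ Set.Icc (0 : ℝ) 1, r * (s - r) / (r + u * (s - r)) - p.eval u =
      r * (s - r) / (r + u * (s - r)) * (q.eval u / q.eval a) := by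
    intro u hu
    have h1 := congrArg (eval u) hp₀
    simp only [eval_sub, eval_mul, eval_C, eval_X] at h1
    have h3 : (r + u * (s - r)) = (s - r) * (u - a) := by linear_combination hax
    have hDu := hD u hu
    rw [h3] at hDu ⊢
    have hua : u - a ≠ 0 := right_ne_zero_of_mul hDu.ne'
    have h4 : p.eval u = r / q.eval a * p₀.eval u := by simp [p]
    rw [h4]
    field_simp
    linear_combination h1
  have hnode : ∀ i, r * (s - r) / (r + t i * (s - r)) = p.eval (t i) := fun i => by
    have := hdiff (t i) (hti i)
    rw [hqt, zero_div, mul_zero] at this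
    linarith
  simp only [hnode]
  rw [← h.exact p (by omega)]
  refine intervalIntegral.integral_mono_on zero_le_one
    (intervalIntegrable_eval_mul_jacobiWeight h0 h2 p)
    (intervalIntegrable_mul_jacobiWeight h0 h2 (ContinuousOn.div (by fun_prop) (by fun_prop)
      fun u hu => (hD u hu).ne')) fun u hu => ?_
  refine mul_le_mul_of_nonneg_right ?_ (jacobiWeight_nonneg α hu)
  rw [← sub_nonneg, hdiff u hu]
  -- The sign of q(a) is that of a-1, opposite to that of s-r. It cancels the sign of f and of X-1,
  -- leaving (s-r)² and a square.
  have ha1 : (a - 1) * (s - r) = -s := by linear_combination hax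
  have h5 : r * (s - r) / (r + u * (s - r)) * (q.eval u / q.eval a) =
      r * (s - r) ^ 2 * (1 - u) / (s * (r + u * (s - r))) * (N.eval u / N.eval a) ^ 2 := by
    have hDu := (hD u hu).ne'
    have ha1' : a - 1 ≠ 0 := left_ne_zero_of_mul (ha1 ▸ (neg_ne_zero.2 hs.ne'))
    have hs' : s = -((a - 1) * (s - r)) := by linear_combination ha1
    simp only [q, eval_mul, eval_sub, eval_X, eval_C, eval_pow]
    generalize r + u * (s - r) = D at *
    rw [div_mul_div_comm, div_pow, div_mul_div_comm, div_eq_div_iff (by positivity) (by positivity)]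
    linear_combination (r * (s - r) * (u - 1) * N.eval u ^ 2 * D * N.eval a ^ 2) * hs'
  rw [h5]
  have := hD u hu
  have := sub_nonneg.2 hu.2
  positivity

end IsGaussRadauJacobi

/-- Approximate f uniformly by a polynomial, on which the rule is eventually exact. Since the
weights are positive with total mass W, replacing f by the polynomial costs at most W times the
uniform error in both the sum and the integral. -/
theorem tendsto_quadrature {α : ℝ} (h0 : 0 < α) (h2 : α < 2) {t w : (m : ℕ) → Fin m → ℝ}
    (h : ∀ m : ℕ, 1 ≤ m → IsGaussRadauJacobi α m (t m) (w m)) {f : ℝ → ℝ}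
    (hf : ContinuousOn f (Set.Icc 0 1)) :
    Tendsto (fun m => ∑ i, w m i * f (t m i)) atTop
      (𝓝 (∫ u in (0 : ℝ)..1, f u * jacobiWeight α u)) := by
  set W := ∫ u in (0 : ℝ)..1, jacobiWeight α u with hW
  have hW0 : 0 ≤ W := intervalIntegral.integral_nonneg zero_le_one fun u hu =>
    jacobiWeight_nonneg α hu
  rw [Metric.tendsto_atTop]
  intro ε hε
  obtain ⟨p, hp⟩ := exists_polynomial_near_of_continuousOn 0 1 f hf (ε / (2 * (W + 1)))
    (by positivity)
  refine ⟨p.natDegree + 2, fun m hm => ?_⟩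
  obtain ⟨n, rfl⟩ : ∃ n, m = n + 1 := ⟨m - 1, by omega⟩
  have hq := h (n + 1) (by omega)
  have hexact := hq.exact p (by omega)
  have hint : |(∫ u in (0 : ℝ)..1, p.eval u * jacobiWeight α u) -
      ∫ u in (0 : ℝ)..1, f u * jacobiWeight α u| ≤ ε / (2 * (W + 1)) * W := by
    rw [← intervalIntegral.integral_sub (intervalIntegrable_eval_mul_jacobiWeight h0 h2 p)
      (intervalIntegrable_mul_jacobiWeight h0 h2 hf), hW, ← intervalIntegral.integral_const_mul]
    refine (intervalIntegral.abs_integral_le_integral_abs zero_le_one).trans ?_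
    have hi := (intervalIntegrable_eval_mul_jacobiWeight h0 h2 p).sub
      (intervalIntegrable_mul_jacobiWeight h0 h2 hf)
    refine intervalIntegral.integral_mono_on zero_le_one hi.abs
      ((intervalIntegrable_jacobiWeight h0 h2).const_mul _) fun u hu => ?_
    rw [← sub_mul, abs_mul, abs_of_nonneg (jacobiWeight_nonneg α hu)]
    exact mul_le_mul_of_nonneg_right (hp u hu).le (jacobiWeight_nonneg α hu)
  have hsum : |∑ i, w (n + 1) i * f (t (n + 1) i) - ∑ i, w (n + 1) i * p.eval (t (n + 1) i)| ≤
      ε / (2 * (W + 1)) * W := by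
    have hsw : ε / (2 * (W + 1)) * W = ∑ i, ε / (2 * (W + 1)) * w (n + 1) i := by
      rw [← Finset.mul_sum, hq.sum_weight]
    rw [← Finset.sum_sub_distrib, hsw]
    refine (Finset.abs_sum_le_sum_abs _ _).trans (Finset.sum_le_sum fun i _ => ?_)
    have hwi := (hq.weight_pos h0 h2 i).le
    rw [← mul_sub, abs_mul, abs_of_nonneg hwi, abs_sub_comm,
      mul_comm]
    exact mul_le_mul_of_nonneg_right
      (hp _ (Set.Ioc_subset_Icc_self (hq.node_mem h0 h2 i))).le hwi
  rw [Real.dist_eq]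
  rw [hexact] at hint
  have htri := abs_sub_le (∑ i, w (n + 1) i * f (t (n + 1) i))
    (∑ i, w (n + 1) i * p.eval (t (n + 1) i)) (∫ u in (0 : ℝ)..1, f u * jacobiWeight α u)
  have hlt : ε / (2 * (W + 1)) * W + ε / (2 * (W + 1)) * W < ε := by
    have : ε / (2 * (W + 1)) * W + ε / (2 * (W + 1)) * W = ε * (W / (W + 1)) := by
      field_simp; ring
    rw [this]
    exact mul_lt_of_lt_one_right hε ((div_lt_one (by positivity)).2 (by linarith))
  linarith

/-! ### Spectral expansion of the trace and the objective. -/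

section Operators

variable {H : Type*} [NormedAddCommGroup H] [InnerProductSpace ℂ H]

theorem finite_real_spectrum [FiniteDimensional ℂ H]
    (a : H →L[ℂ] H) : (spectrum ℝ a).Finite := by
  have h : (spectrum ℂ a).Finite := by
    rw [← AlgEquiv.spectrum_eq (Module.End.toContinuousLinearMap H).symm a]
    exact Module.End.finite_spectrum _
  exact (h.preimage (FaithfulSMul.algebraMap_injective ℝ ℂ).injOn).subset fun x hx =>
    (spectrum.algebraMap_mem_iff ℂ).2 hx

theorem aeval_apply_of_apply_eq_smul {a : H →L[ℂ] H} {v : H} {x : ℝ} (hv : a v = (x : ℂ) • v)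
    (p : Polynomial ℝ) : Polynomial.aeval a p v = ((p.eval x : ℝ) : ℂ) • v := by
  induction p using Polynomial.induction_on' with
  | add p q hp hq => simp [hp, hq, add_smul]
  | monomial n c =>
    have hpow : (a ^ n) v = ((x : ℂ) ^ n) • v := by
      induction n with
      | zero => simp
      | succ n ih =>
        rw [pow_succ', mul_apply_eq_comp, ih, map_smul, hv, smul_smul, pow_succ]
    rw [Polynomial.aeval_monomial, mul_apply_eq_comp, hpow, Polynomial.eval_monomial,
      Algebra.algebraMap_eq_smul_one]
    simp only [smul_apply, one_apply_eq_self]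
    push_cast
    rw [mul_smul, Complex.coe_smul]

/-- On a finite spectrum every function agrees with an interpolating polynomial, so no continuity of
f is needed, and negative powers are covered. -/
theorem cfc_apply_of_apply_eq_smul [CompleteSpace H] [FiniteDimensional ℂ H]
    {a : H →L[ℂ] H} (ha : IsSelfAdjoint a) {v : H} {x : ℝ}
    (hv : a v = (x : ℂ) • v) (f : ℝ → ℝ) : cfc f a v = ((f x : ℝ) : ℂ) • v := by
  classical
  -- Inserting x also covers v = 0, where x need not lie in the spectrum.
  let S : Finset ℝ := insert x (finite_real_spectrum a).toFinset
  let p : Polynomial ℝ := Lagrange.interpolate S id f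
  have hp : ∀ y ∈ S, p.eval y = f y := fun y hy =>
    Lagrange.eval_interpolate_at_node f (v := id) (Set.injOn_id _) hy
  have h1 : cfc f a = Polynomial.aeval a p := by
    rw [← cfc_polynomial p a ha]
    refine cfc_congr fun y hy => (hp y ?_).symm
    exact Finset.mem_insert_of_mem ((finite_real_spectrum a).mem_toFinset.2 hy)
  rw [h1, aeval_apply_of_apply_eq_smul hv, hp x (Finset.mem_insert_self _ _)]

theorem rpow_apply_of_apply_eq_smul [CompleteSpace H] [FiniteDimensional ℂ H]
    {a : H →L[ℂ] H} (ha : a.IsPositive) {v : H} {x : ℝ}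
    (hv : a v = (x : ℂ) • v) (s : ℝ) : (a ^ s) v = ((x ^ s : ℝ) : ℂ) • v := by
  rw [CFC.rpow_eq_cfc_real ((ContinuousLinearMap.nonneg_iff_isPositive a).2 ha)]
  exact cfc_apply_of_apply_eq_smul ha.isSelfAdjoint hv _

theorem exists_orthonormal_eigenbasis [FiniteDimensional ℂ H]
    {a : H →L[ℂ] H} (ha : a.IsPositive) :
    ∃ (e : OrthonormalBasis (Fin (Module.finrank ℂ H)) ℂ H) (r : Fin (Module.finrank ℂ H) → ℝ),
      (∀ j, 0 ≤ r j) ∧ ∀ j, a (e j) = (r j : ℂ) • e j := by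
  have hs := ha.isSymmetric
  refine ⟨hs.eigenvectorBasis rfl, hs.eigenvalues rfl, fun j => ?_, fun j => ?_⟩
  · exact LinearMap.IsPositive.nonneg_eigenvalues
      ((ContinuousLinearMap.isPositive_toLinearMap_iff a).2 ha) rfl j
  · exact hs.apply_eigenvectorBasis rfl j

variable {ι κ : Type*} [Fintype ι] [Fintype κ]

theorem tr_eq_sum_inner (A : H →L[ℂ] H) (e : OrthonormalBasis ι ℂ H) :
    tr A = ∑ j, (inner ℂ (e j) (A (e j))).re := by
  rw [tr, LinearMap.trace_eq_sum_inner _ e, Complex.re_sum]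
  rfl

theorem tr_mul_eq_sum {a : H →L[ℂ] H} (ha : a.IsPositive) (e : OrthonormalBasis ι ℂ H)
    {r : ι → ℝ} (he : ∀ j, a (e j) = (r j : ℂ) • e j) (A : H →L[ℂ] H) :
    tr (a * A) = ∑ j, r j * (inner ℂ (e j) (A (e j))).re := by
  rw [tr_eq_sum_inner _ e]
  refine Finset.sum_congr rfl fun j _ => ?_
  rw [mul_apply_eq_comp, ← ha.inner_left_eq_inner_right, he, inner_smul_left,
    Complex.conj_ofReal, Complex.re_ofReal_mul]

/-- Expanding Z e_j in `f` and Z† f_k in `e` expresses both quadratic terms through the same entries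
⟨f_k, Z e_j⟩, so the objective decouples. -/
theorem objective_eq_sum [CompleteSpace H]
    {ρ σ : H →L[ℂ] H} (hρ : ρ.IsPositive) (hσ : σ.IsPositive)
    (e : OrthonormalBasis ι ℂ H) (f : OrthonormalBasis κ ℂ H) {r : ι → ℝ} {s : κ → ℝ}
    (he : ∀ j, ρ (e j) = (r j : ℂ) • e j) (hf : ∀ k, σ (f k) = (s k : ℂ) • f k) (t : ℝ)
    (Z : H →L[ℂ] H) :
    objective ρ σ t Z = ∑ j, ∑ k,
      (2 * r j * (inner ℂ (e j) (f k) * inner ℂ (f k) (Z (e j))).re +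
        ((1 - t) * r j + t * s k) * ‖inner ℂ (f k) (Z (e j))‖ ^ 2) := by
  have h1 : ∀ j, (inner ℂ (e j) ((Z + star Z + ((1 - t : ℝ) : ℂ) • (star Z * Z)) (e j))).re =
      ∑ k, (2 * (inner ℂ (e j) (f k) * inner ℂ (f k) (Z (e j))).re +
        (1 - t) * ‖inner ℂ (f k) (Z (e j))‖ ^ 2) := by
    intro j
    have hstar : (inner ℂ (e j) (star Z (e j))).re = (inner ℂ (e j) (Z (e j))).re := by
      rw [ContinuousLinearMap.star_eq_adjoint, ContinuousLinearMap.adjoint_inner_right,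
        ← inner_conj_symm, Complex.conj_re]
    have hsq : inner ℂ (e j) (star Z (Z (e j))) = ((‖Z (e j)‖ ^ 2 : ℝ) : ℂ) := by
      rw [ContinuousLinearMap.star_eq_adjoint, ContinuousLinearMap.adjoint_inner_right,
        inner_self_eq_norm_sq_to_K]
      push_cast
      rfl
    simp only [add_apply, smul_apply,
      mul_apply_eq_comp, inner_add_right, inner_smul_right, Complex.add_re, hsq]
    rw [hstar, Complex.re_ofReal_mul, Complex.ofReal_re, ← f.sum_inner_mul_inner,
      ← f.sum_sq_norm_inner_right, Complex.re_sum, Finset.sum_add_distrib, ← Finset.mul_sum,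
      ← Finset.mul_sum]
    ring
  have h2 : ∀ k, (inner ℂ (f k) ((Z * star Z) (f k))).re =
      ∑ j, ‖inner ℂ (f k) (Z (e j))‖ ^ 2 := by
    intro k
    rw [mul_apply_eq_comp, ← ContinuousLinearMap.adjoint_inner_left,
      ContinuousLinearMap.star_eq_adjoint, inner_self_eq_norm_sq_to_K]
    norm_cast
    rw [← e.sum_sq_norm_inner_left]
    refine Finset.sum_congr rfl fun j _ => ?_
    rw [ContinuousLinearMap.adjoint_inner_left]
  rw [objective, tr_mul_eq_sum hρ e he, tr_mul_eq_sum hσ f hf]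
  simp only [h1, h2]
  simp only [Finset.mul_sum]
  rw [Finset.sum_comm (γ := κ), ← Finset.sum_add_distrib]
  refine Finset.sum_congr rfl fun j _ => ?_
  rw [← Finset.sum_add_distrib]
  refine Finset.sum_congr rfl fun k _ => ?_
  ring

/-- Completing the square in z. If D = 0 the quotient is 0 by convention, and `h0` removes the
linear term, which would otherwise be unbounded below. -/
theorem neg_le_linear_add_quadratic {r D : ℝ} (hD : 0 ≤ D) {u : ℂ}
    (h0 : D = 0 → (r : ℂ) * u = 0) (z : ℂ) :
    -(r ^ 2 / D * ‖u‖ ^ 2) ≤ 2 * r * (u * z).re + D * ‖z‖ ^ 2 := by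
  rcases hD.eq_or_lt with h | h
  · have h1 := h0 h.symm
    have h2 : r * (u * z).re = 0 := by
      rw [← Complex.re_ofReal_mul, ← mul_assoc, h1, zero_mul, Complex.zero_re]
    rw [← h, div_zero, zero_mul, zero_mul, neg_zero, mul_assoc, h2]
    simp
  · have h1 : -(‖u‖ * ‖z‖) ≤ (u * z).re ∧ (u * z).re ≤ ‖u‖ * ‖z‖ := by
      rw [← abs_le, ← norm_mul]
      exact Complex.abs_re_le_norm _
    have h2 : -(|r| * (‖u‖ * ‖z‖)) ≤ r * (u * z).re := by
      have : |r * (u * z).re| ≤ |r| * (‖u‖ * ‖z‖) := by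
        rw [abs_mul]
        exact mul_le_mul_of_nonneg_left (abs_le.2 h1) (abs_nonneg r)
      exact (abs_le.1 this).1
    have h3 : 0 ≤ (|r| * ‖u‖ - D * ‖z‖) ^ 2 / D := by positivity
    have h4 : (|r| * ‖u‖ - D * ‖z‖) ^ 2 / D =
        r ^ 2 / D * ‖u‖ ^ 2 - 2 * (|r| * (‖u‖ * ‖z‖)) + D * ‖z‖ ^ 2 := by
      rw [← sq_abs r]
      field_simp
      ring
    linarith

theorem linear_add_quadratic_minimizer (r D : ℝ) (u : ℂ) :
    2 * r * (u * (-((r / D : ℝ) : ℂ) * starRingEnd ℂ u)).re +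
      D * ‖-((r / D : ℝ) : ℂ) * starRingEnd ℂ u‖ ^ 2 = -(r ^ 2 / D * ‖u‖ ^ 2) := by
  have h1 : u * (-((r / D : ℝ) : ℂ) * starRingEnd ℂ u) = ((-(r / D) * ‖u‖ ^ 2 : ℝ) : ℂ) := by
    rw [mul_left_comm, Complex.mul_conj, Complex.normSq_eq_norm_sq]
    push_cast
    ring
  rw [h1, Complex.ofReal_re, norm_mul, norm_neg, Complex.norm_real, RCLike.norm_conj, mul_pow,
    Real.norm_eq_abs, sq_abs]
  rcases eq_or_ne D 0 with rfl | hD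
  · simp
  · field_simp
    ring

theorem mul_inner_eq_zero_of_dominated {ρ σ : H →L[ℂ] H} (hρ : ρ.IsPositive)
    (hdom : Dominated ρ σ) (e : OrthonormalBasis ι ℂ H) (f : OrthonormalBasis κ ℂ H)
    {r : ι → ℝ} {s : κ → ℝ} (he : ∀ j, ρ (e j) = (r j : ℂ) • e j)
    (hf : ∀ k, σ (f k) = (s k : ℂ) • f k) {j : ι} {k : κ} (hk : s k = 0) :
    (r j : ℂ) * inner ℂ (e j) (f k) = 0 := by
  have h1 : ρ (f k) = 0 := hdom _ (by rw [hf, hk, Complex.ofReal_zero, zero_smul])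
  have h2 := hρ.inner_left_eq_inner_right (e j) (f k)
  rwa [h1, inner_zero_right, he, inner_smul_left, Complex.conj_ofReal] at h2

theorem petzTrace_eq_sum [CompleteSpace H] [FiniteDimensional ℂ H]
    {ρ σ : H →L[ℂ] H} (hρ : ρ.IsPositive) (hσ : σ.IsPositive)
    (e : OrthonormalBasis ι ℂ H) (f : OrthonormalBasis κ ℂ H) {r : ι → ℝ} {s : κ → ℝ}
    (he : ∀ j, ρ (e j) = (r j : ℂ) • e j) (hf : ∀ k, σ (f k) = (s k : ℂ) • f k) (α : ℝ) :
    petzTrace α ρ σ =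
      ∑ j, ∑ k, r j ^ α * s k ^ (1 - α) * ‖inner ℂ (e j) (f k)‖ ^ 2 := by
  rw [petzTrace, tr_eq_sum_inner _ f, Finset.sum_comm]
  refine Finset.sum_congr rfl fun k _ => ?_
  have h1 : (ρ ^ α) (f k) = ∑ j, inner ℂ (e j) (f k) • ((r j ^ α : ℝ) : ℂ) • e j := by
    conv_lhs => rw [← e.sum_repr' (f k)]
    rw [map_sum]
    refine Finset.sum_congr rfl fun j _ => ?_
    rw [map_smul, rpow_apply_of_apply_eq_smul hρ (he j)]
  rw [mul_apply_eq_comp, rpow_apply_of_apply_eq_smul hσ (hf k), map_smul, h1,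
    inner_smul_right, inner_sum, Complex.re_ofReal_mul, Complex.re_sum, Finset.mul_sum]
  refine Finset.sum_congr rfl fun j _ => ?_
  rw [inner_smul_right, inner_smul_right, mul_left_comm, Complex.re_ofReal_mul,
    ← inner_conj_symm (f k) (e j), Complex.mul_conj, Complex.ofReal_re, Complex.normSq_eq_norm_sq]
  ring

theorem isLeast_range_objective [CompleteSpace H] [FiniteDimensional ℂ H]
    {ρ σ : H →L[ℂ] H} (hρ : ρ.IsPositive) (hσ : σ.IsPositive)
    (hdom : Dominated ρ σ) (e : OrthonormalBasis ι ℂ H) (f : OrthonormalBasis κ ℂ H)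
    {r : ι → ℝ} {s : κ → ℝ} (hr : ∀ j, 0 ≤ r j) (hs : ∀ k, 0 ≤ s k)
    (he : ∀ j, ρ (e j) = (r j : ℂ) • e j) (hf : ∀ k, σ (f k) = (s k : ℂ) • f k) {t : ℝ}
    (ht : t ∈ Set.Ioc (0 : ℝ) 1) :
    IsLeast (Set.range (objective ρ σ t))
      (-∑ j, ∑ k, r j ^ 2 / ((1 - t) * r j + t * s k) * ‖inner ℂ (e j) (f k)‖ ^ 2) := by
  simp only [← Finset.sum_neg_distrib]
  constructor
  · let z : ι → κ → ℂ := fun j k =>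
      -((r j / ((1 - t) * r j + t * s k) : ℝ) : ℂ) * starRingEnd ℂ (inner ℂ (e j) (f k))
    let Z : H →L[ℂ] H := LinearMap.toContinuousLinearMap
      (e.toBasis.constr ℂ fun j => ∑ k, z j k • f k)
    have hZ : ∀ j k, inner ℂ (f k) (Z (e j)) = z j k := by
      intro j k
      have : Z (e j) = ∑ k, z j k • f k := by
        simp only [Z, LinearMap.coe_toContinuousLinearMap']
        rw [← e.coe_toBasis, Module.Basis.constr_basis]
      rw [this, f.orthonormal.inner_right_fintype]
    refine ⟨Z, ?_⟩
    rw [objective_eq_sum hρ hσ e f he hf]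
    refine Finset.sum_congr rfl fun j _ => Finset.sum_congr rfl fun k _ => ?_
    rw [hZ]
    exact linear_add_quadratic_minimizer _ _ _
  · rintro _ ⟨Z, rfl⟩
    rw [objective_eq_sum hρ hσ e f he hf]
    refine Finset.sum_le_sum fun j _ => Finset.sum_le_sum fun k _ => ?_
    have h1 := mul_nonneg (sub_nonneg.2 ht.2) (hr j)
    have h2 := mul_nonneg ht.1.le (hs k)
    refine neg_le_linear_add_quadratic (add_nonneg h1 h2) (fun h0 => ?_) _
    -- Both summands of the denominator are nonnegative, and t > 0, so its vanishing forces s_k = 0.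
    have hsk : s k = 0 := by
      have : t * s k = 0 := by linarith
      exact (mul_eq_zero.1 this).resolve_left ht.1.ne'
    exact mul_inner_eq_zero_of_dominated hρ hdom e f he hf hsk

end Operators

/-! ### The scalar bounds. -/

/-- The bound for commuting one-dimensional operators `r` and `s`. -/
noncomputable def scalarBound (α : ℝ) {m : ℕ} (t w : Fin m → ℝ) (r s : ℝ) : ℝ :=
  r + Real.sin (α * Real.pi) / Real.pi *
    ∑ i, w i / t i * (r - r ^ 2 / ((1 - t i) * r + t i * s))

theorem scalarBound_eq (α : ℝ) {m : ℕ} {t w : Fin m → ℝ}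
    (ht : ∀ i, t i ∈ Set.Ioc (0 : ℝ) 1) {r s : ℝ} (hr : 0 < r) (hs : 0 < s) :
    scalarBound α t w r s = r + Real.sin (α * Real.pi) / Real.pi *
      ∑ i, w i * (r * (s - r) / (r + t i * (s - r))) := by
  rw [scalarBound]
  congr 2
  refine Finset.sum_congr rfl fun i _ => ?_
  have h0 := (ht i).1
  have hD : 0 < (1 - t i) * r + t i * s :=
    add_pos_of_nonneg_of_pos (mul_nonneg (sub_nonneg.2 (ht i).2) hr.le) (mul_pos h0 hs)
  have hD' : r + t i * (s - r) = (1 - t i) * r + t i * s := by ring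
  -- The factor t_i gained here cancels the 1/t_i in the coefficients.
  have h1 : r - r ^ 2 / ((1 - t i) * r + t i * s) =
      t i * (r * (s - r) / ((1 - t i) * r + t i * s)) := by
    rw [eq_comm, ← mul_div_assoc, eq_sub_iff_add_eq, ← add_div, div_eq_iff hD.ne']
    ring
  rw [hD', h1, ← mul_assoc, div_mul_cancel₀ _ h0.ne']

theorem scalarBound_le {α : ℝ} (h0 : 0 < α) (h1 : α < 1) {n : ℕ} {t w : Fin (n + 1) → ℝ}
    (h : IsGaussRadauJacobi α (n + 1) t w) {r s : ℝ} (hr : 0 < r) (hs : 0 < s) :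
    scalarBound α t w r s ≤ r ^ α * s ^ (1 - α) := by
  have h2 : α < 2 := by linarith
  rw [scalarBound_eq α (h.node_mem h0 h2) hr hs,
    ← integral_rational_mul_jacobiWeight (Or.inl ⟨h0, h1⟩) hr hs]
  have hsin : 0 < Real.sin (α * Real.pi) :=
    Real.sin_pos_of_pos_of_lt_pi (mul_pos h0 Real.pi_pos) (by nlinarith [Real.pi_pos])
  have := h.sum_rational_le_integral h0 h2 hr hs
  have := mul_le_mul_of_nonneg_left this (div_pos hsin Real.pi_pos).le
  linarith

/-- Here sin(απ) < 0, so the same quadrature underestimate gives the reverse inequality. -/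
theorem le_scalarBound {α : ℝ} (h1 : 1 < α) (h2 : α < 2) {n : ℕ} {t w : Fin (n + 1) → ℝ}
    (h : IsGaussRadauJacobi α (n + 1) t w) {r s : ℝ} (hr : 0 < r) (hs : 0 < s) :
    r ^ α * s ^ (1 - α) ≤ scalarBound α t w r s := by
  have h0 : 0 < α := by linarith
  rw [scalarBound_eq α (h.node_mem h0 h2) hr hs,
    ← integral_rational_mul_jacobiWeight (Or.inr ⟨h1, h2⟩) hr hs]
  have hsin : 0 < Real.sin ((α - 1) * Real.pi) :=
    Real.sin_pos_of_pos_of_lt_pi (mul_pos (sub_pos.2 h1) Real.pi_pos)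
      (by nlinarith [Real.pi_pos])
  rw [sub_mul, one_mul, Real.sin_sub_pi] at hsin
  have := h.sum_rational_le_integral h0 h2 hr hs
  have := mul_le_mul_of_nonpos_left this
    (div_neg_of_neg_of_pos (neg_pos.1 hsin) Real.pi_pos).le
  linarith

theorem tendsto_scalarBound {α : ℝ} (hα : α ∈ Set.Ioo (0 : ℝ) 1 ∪ Set.Ioo (1 : ℝ) 2)
    (h0 : 0 < α) (h2 : α < 2) {t w : (m : ℕ) → Fin m → ℝ}
    (h : ∀ m : ℕ, 1 ≤ m → IsGaussRadauJacobi α m (t m) (w m)) {r s : ℝ} (hr : 0 < r)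
    (hs : 0 < s) :
    Tendsto (fun m => scalarBound α (t m) (w m) r s) atTop (𝓝 (r ^ α * s ^ (1 - α))) := by
  rw [← integral_rational_mul_jacobiWeight hα hr hs]
  have hcont : ContinuousOn (fun u : ℝ => r * (s - r) / (r + u * (s - r))) (Set.Icc 0 1) := by
    refine ContinuousOn.div (by fun_prop) (by fun_prop) fun u hu => ne_of_gt ?_
    rcases hu.2.eq_or_lt with rfl | h1
    · linarith
    · nlinarith [mul_pos hr (sub_pos.2 h1), mul_nonneg hu.1 hs.le]
  refine (((tendsto_quadrature h0 h2 h hcont).const_mul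
    (Real.sin (α * Real.pi) / Real.pi)).const_add r).congr' ?_
  filter_upwards [eventually_ge_atTop 1] with m hm
  obtain ⟨n, rfl⟩ : ∃ n, m = n + 1 := ⟨m - 1, by omega⟩
  rw [scalarBound_eq α ((h _ hm).node_mem h0 h2) hr hs]

theorem scalarBound_zero_left (α : ℝ) {m : ℕ} (t w : Fin m → ℝ) (s : ℝ) :
    scalarBound α t w 0 s = 0 := by
  simp [scalarBound]

/-! ### From scalars back to operators. -/

section Operators

variable {H : Type*} [NormedAddCommGroup H] [InnerProductSpace ℂ H]
  {ι κ : Type*} [Fintype ι] [Fintype κ]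

theorem tr_eq_sum_sum {ρ : H →L[ℂ] H} (e : OrthonormalBasis ι ℂ H) (f : OrthonormalBasis κ ℂ H)
    {r : ι → ℝ} (he : ∀ j, ρ (e j) = (r j : ℂ) • e j) :
    tr ρ = ∑ j, ∑ k, r j * ‖inner ℂ (e j) (f k)‖ ^ 2 := by
  rw [tr_eq_sum_inner _ e]
  refine Finset.sum_congr rfl fun j _ => ?_
  rw [he, inner_smul_right, Complex.re_ofReal_mul, ← Finset.mul_sum, f.sum_sq_norm_inner_left,
    inner_self_eq_norm_sq_to_K, e.orthonormal.norm_eq_one]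
  simp

theorem quadratureBound_eq_sum [CompleteSpace H] [FiniteDimensional ℂ H] {ρ σ : H →L[ℂ] H}
    (hρ : ρ.IsPositive) (hσ : σ.IsPositive)
    (hdom : Dominated ρ σ) (e : OrthonormalBasis ι ℂ H) (f : OrthonormalBasis κ ℂ H)
    {r : ι → ℝ} {s : κ → ℝ} (hr : ∀ j, 0 ≤ r j) (hs : ∀ k, 0 ≤ s k)
    (he : ∀ j, ρ (e j) = (r j : ℂ) • e j) (hf : ∀ k, σ (f k) = (s k : ℂ) • f k) (α : ℝ)
    {m : ℕ} {t w : Fin m → ℝ} (ht : ∀ i, t i ∈ Set.Ioc (0 : ℝ) 1) :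
    quadratureBound α t w ρ σ =
      ∑ j, ∑ k, scalarBound α t w (r j) (s k) * ‖inner ℂ (e j) (f k)‖ ^ 2 := by
  have hinf : ∀ i, ⨅ Z : H →L[ℂ] H, objective ρ σ (t i) Z =
      -∑ j, ∑ k, r j ^ 2 / ((1 - t i) * r j + t i * s k) * ‖inner ℂ (e j) (f k)‖ ^ 2 :=
    fun i => (isLeast_range_objective hρ hσ hdom e f hr hs he hf (ht i)).csInf_eq
  have hterm : ∀ i, w i / t i * (tr ρ + ⨅ Z : H →L[ℂ] H, objective ρ σ (t i) Z) =
      ∑ j, ∑ k, w i / t i * (r j - r j ^ 2 / ((1 - t i) * r j + t i * s k)) *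
        ‖inner ℂ (e j) (f k)‖ ^ 2 := by
    intro i
    rw [hinf, tr_eq_sum_sum e f he, ← sub_eq_add_neg, ← Finset.sum_sub_distrib, Finset.mul_sum]
    refine Finset.sum_congr rfl fun j _ => ?_
    rw [← Finset.sum_sub_distrib, Finset.mul_sum]
    refine Finset.sum_congr rfl fun k _ => ?_
    ring
  -- The constant C_m is distributed over the nodes, pairing one copy of Tr ρ with each infimum.
  have hbound : quadratureBound α t w ρ σ = tr ρ + Real.sin (α * Real.pi) / Real.pi *
      ∑ i, w i / t i * (tr ρ + ⨅ Z : H →L[ℂ] H, objective ρ σ (t i) Z) := by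
    rw [quadratureBound]
    simp only [mul_add, Finset.sum_add_distrib, ← Finset.sum_mul]
    ring
  rw [hbound]
  simp only [hterm]
  rw [tr_eq_sum_sum e f he, Finset.sum_comm (s := (Finset.univ : Finset (Fin m))), Finset.mul_sum,
    ← Finset.sum_add_distrib]
  refine Finset.sum_congr rfl fun j _ => ?_
  rw [Finset.sum_comm (s := (Finset.univ : Finset (Fin m))), Finset.mul_sum,
    ← Finset.sum_add_distrib]
  refine Finset.sum_congr rfl fun k _ => ?_
  rw [scalarBound, ← Finset.sum_mul]
  ring

/-- The pairs of eigenvalues that contribute to the traces are positive. -/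
theorem pos_of_ne_zero_of_dominated {ρ σ : H →L[ℂ] H} (hρ : ρ.IsPositive)
    (hdom : Dominated ρ σ) (e : OrthonormalBasis ι ℂ H) (f : OrthonormalBasis κ ℂ H)
    {r : ι → ℝ} {s : κ → ℝ} (hr : ∀ j, 0 ≤ r j) (hs : ∀ k, 0 ≤ s k)
    (he : ∀ j, ρ (e j) = (r j : ℂ) • e j) (hf : ∀ k, σ (f k) = (s k : ℂ) • f k) (j : ι) (k : κ) :
    r j = 0 ∨ inner ℂ (e j) (f k) = 0 ∨ (0 < r j ∧ 0 < s k) := by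
  rcases (hr j).eq_or_lt with h | h
  · exact Or.inl h.symm
  rcases (hs k).eq_or_lt with h' | h'
  · have := mul_inner_eq_zero_of_dominated hρ hdom e f he hf (j := j) h'.symm
    exact Or.inr (Or.inl ((mul_eq_zero.1 this).resolve_left (Complex.ofReal_ne_zero.2 h.ne')))
  · exact Or.inr (Or.inr ⟨h, h'⟩)

end Operators

end PetzRenyi

theorem theorem3 (α : ℝ) (hα : α ∈ Set.Ioo (0 : ℝ) 1 ∪ Set.Ioo (1 : ℝ) 2) :
    -- For every `m ≥ 1` the quadrature rule exists.
    (∀ m : ℕ, 1 ≤ m → ∃ t w : Fin m → ℝ, PetzRenyi.IsGaussRadauJacobi α m t w) ∧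
    -- However the rules are given, they have the following properties.
    ∀ t w : (m : ℕ) → Fin m → ℝ,
      (∀ m : ℕ, 1 ≤ m → PetzRenyi.IsGaussRadauJacobi α m (t m) (w m)) →
      (∀ m : ℕ, 1 ≤ m → ∀ i : Fin m, t m i ∈ Set.Ioc (0 : ℝ) 1 ∧ 0 < w m i) ∧
      ∀ (H : Type*) [NormedAddCommGroup H] [InnerProductSpace ℂ H] [CompleteSpace H]
        [FiniteDimensional ℂ H] (ρ σ : H →L[ℂ] H),
        ρ.IsPositive → σ.IsPositive → PetzRenyi.Dominated ρ σ →
        -- All the infima are finite.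
        (∀ m : ℕ, 1 ≤ m → ∀ i : Fin m,
          BddBelow (Set.range (PetzRenyi.objective ρ σ (t m i)))) ∧
        -- Lower bound for `α < 1`, upper bound for `α > 1`.
        (α < 1 → ∀ m : ℕ, 1 ≤ m →
          PetzRenyi.quadratureBound α (t m) (w m) ρ σ ≤ PetzRenyi.petzTrace α ρ σ) ∧
        (1 < α → ∀ m : ℕ, 1 ≤ m →
          PetzRenyi.petzTrace α ρ σ ≤ PetzRenyi.quadratureBound α (t m) (w m) ρ σ) ∧
        -- Convergence of the bounds.
        Tendsto (fun m : ℕ => PetzRenyi.quadratureBound α (t m) (w m) ρ σ) atTop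
          (𝓝 (PetzRenyi.petzTrace α ρ σ)) := by
  have h0 : 0 < α := hα.elim (fun h => h.1) fun h => zero_lt_one.trans h.1
  have h2 : α < 2 := hα.elim (fun h => h.2.trans one_lt_two) fun h => h.2
  refine ⟨fun m hm => ?_, fun t w hq => ?_⟩
  · obtain ⟨n, rfl⟩ : ∃ n, m = n + 1 := ⟨m - 1, by omega⟩
    exact PetzRenyi.exists_isGaussRadauJacobi h0 h2 n
  have hnode : ∀ m : ℕ, 1 ≤ m → ∀ i : Fin m, t m i ∈ Set.Ioc (0 : ℝ) 1 := fun m hm i => by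
    obtain ⟨n, rfl⟩ : ∃ n, m = n + 1 := ⟨m - 1, by omega⟩
    exact (hq _ hm).node_mem h0 h2 i
  have hweight : ∀ m : ℕ, 1 ≤ m → ∀ i : Fin m, 0 < w m i := fun m hm i => by
    obtain ⟨n, rfl⟩ : ∃ n, m = n + 1 := ⟨m - 1, by omega⟩
    exact (hq _ hm).weight_pos h0 h2 i
  refine ⟨fun m hm i => ⟨hnode m hm i, hweight m hm i⟩, ?_⟩
  intro H _ _ _ _ ρ σ hρ hσ hdom
  obtain ⟨e, r, hr, he⟩ := PetzRenyi.exists_orthonormal_eigenbasis hρ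
  obtain ⟨f, s, hs, hf⟩ := PetzRenyi.exists_orthonormal_eigenbasis hσ
  have hpos := PetzRenyi.pos_of_ne_zero_of_dominated hρ hdom e f hr hs he hf
  have hbound : ∀ m : ℕ, 1 ≤ m → PetzRenyi.quadratureBound α (t m) (w m) ρ σ =
      ∑ j, ∑ k, PetzRenyi.scalarBound α (t m) (w m) (r j) (s k) *
        ‖inner ℂ (e j) (f k)‖ ^ 2 := fun m hm =>
    PetzRenyi.quadratureBound_eq_sum hρ hσ hdom e f hr hs he hf α (hnode m hm)
  have htrace := PetzRenyi.petzTrace_eq_sum hρ hσ e f he hf α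
  refine ⟨fun m hm i => ?_, fun h1 m hm => ?_, fun h1 m hm => ?_, ?_⟩
  · exact ⟨_, (PetzRenyi.isLeast_range_objective hρ hσ hdom e f hr hs he hf (hnode m hm i)).2⟩
  · rw [hbound m hm, htrace]
    obtain ⟨n, rfl⟩ : ∃ n, m = n + 1 := ⟨m - 1, by omega⟩
    refine Finset.sum_le_sum fun j _ => Finset.sum_le_sum fun k _ => ?_
    -- Pairs with r_j = 0 contribute 0 to both sides because 0^α = 0, and pairs with zero overlap
    -- contribute nothing.
    rcases hpos j k with h | h | ⟨hrj, hsk⟩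
    · simp [h, PetzRenyi.scalarBound_zero_left, Real.zero_rpow h0.ne']
    · simp [h]
    · exact mul_le_mul_of_nonneg_right (PetzRenyi.scalarBound_le h0 h1 (hq _ hm) hrj hsk)
        (sq_nonneg _)
  · rw [hbound m hm, htrace]
    obtain ⟨n, rfl⟩ : ∃ n, m = n + 1 := ⟨m - 1, by omega⟩
    refine Finset.sum_le_sum fun j _ => Finset.sum_le_sum fun k _ => ?_
    rcases hpos j k with h | h | ⟨hrj, hsk⟩
    · simp [h, PetzRenyi.scalarBound_zero_left, Real.zero_rpow h0.ne']
    · simp [h]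
    · exact mul_le_mul_of_nonneg_right (PetzRenyi.le_scalarBound h1 h2 (hq _ hm) hrj hsk)
        (sq_nonneg _)
  · rw [htrace]
    -- The expansion of the bound is available only for m ≥ 1, hence eventual equality.
    refine Tendsto.congr' (f₁ := fun m => ∑ j, ∑ k,
      PetzRenyi.scalarBound α (t m) (w m) (r j) (s k) * ‖inner ℂ (e j) (f k)‖ ^ 2) ?_ ?_
    · filter_upwards [eventually_ge_atTop 1] with m hm
      exact (hbound m hm).symm
    · refine tendsto_finsetSum _ fun j _ => tendsto_finsetSum _ fun k _ => ?_
      rcases hpos j k with h | h | ⟨hrj, hsk⟩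
      · simp [h, PetzRenyi.scalarBound_zero_left, Real.zero_rpow h0.ne']
      · simp [h]
      · exact (PetzRenyi.tendsto_scalarBound hα h0 h2 hq hrj hsk).mul_const _
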